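/- **Setup.** Let $\bm x=(x_1,\tilde{\bm x}^T)^T\in\mathbb R^p$ ($p\ge 1$) be covariates, $A\in\{0,1\}$ a treatment, $Y_0^*,Y_1^*$ integrable potential outcomes, and $Y=Y_1^*A+Y_0^*(1-A)$ the observed outcome. Assume a randomized trial: $A$ and $(Y_0^*,Y_1^*)$ are conditionally independent given $\bm x$, and $P(A=1\mid \bm x)=1/2$ almost surely. Let $\mathbb B\subset\mathbb R^p$ be compact with $|\beta_1|=1$ for every $\bm\beta=(\beta_1,\tilde{\bm\beta}^T)^T\in\mathbb B$. For $\bm\beta\in\mathbb B$ let $d_{\bm\beta}(\bm x)=I(\bm x^T\bm\beta>0)$ and $V(\bm\beta)=E\{Y_1^*d_{\bm\beta}(\bm x)+Y_0^*(1-d_{\bm\beta}(\bm x))\}$, and let $\bm\beta_0\in\mathbb B$ maximize $V$ over $\mathbb B$. Write $\mu(a,\bm x)=E(Y_a^*\mid\bm x)$, $z=\bm x^T\bm\beta_0$, let $S(z,\tilde{\bm x})$ be a version of $E(Y_1^*-Y_0^*\mid z,\tilde{\bm x})$, and let $f(z\mid\tilde{\bm x})$ be the conditional density of $z$ given $\tilde{\bm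 x}$. **Assumptions.** (A1) For $a=0,1$, $\mu(a,\bm x)$ is bounded for almost all $\bm x$ and, for almost every $\bm x$, the conditional distribution of $Y_a^*-\mu(a,\bm x)$ given $\bm x$ is sub-Gaussian. (A2) The support of the distribution of $\bm x$ is not contained in any proper linear subspace of $\mathbb R^p$; for almost every $\tilde{\bm x}$, the conditional distribution of $x_1$ given $\tilde{\bm x}$ has an everywhere positive density; the components of $\tilde{\bm x}$ are bounded by a constant. (A3) $S(0,\tilde{\bm x})=0$ for almost every $\tilde{\bm x}$, and for every $\varepsilon>0$ $$\sup_{\bm\beta\in\mathbb B,\ \|\bm\beta-\bm\beta_0\|>\varepsilon} E_{\tilde{\bm x}}\int I(\bm x^T\bm\beta>0)\,S(z,\tilde{\bm x})f(z\mid\tilde{\bm x})\,dz \;<\; E_{\tilde{\bm x}}\int I(\bm x^T\bm\beta_0>0)\,S(z,\tilde{\bm x})f(z\mid\tilde{\bm x})\,dz ,$$ where inside the integrals $\bm x$ is the vector determined by $\bm x^T\bm\beta_0=z$ and $\tilde{\bm x}$, and a supremum over the empty set is $-\infty$. (K1) $K:\mathbb R\to\mathbb R$ is twice differentiable; $K,K',K''$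 are of bounded variation on $\mathbb R$; $\lim_{\nu\to-\infty}K(\nu)=0$, $\lim_{\nu\to\infty}K(\nu)=1$; $\int K'(\nu)^2d\nu$ and $\int K''(\nu)^2d\nu$ are finite. **Theorem.** Let $(\bm x_i,A_i,Y_i)$, $i=1,2,\dots$, be independent copies of $(\bm x,A,Y)$, let $h_n>0$ with $h_n\to0$, and for each $n\ge1$ let $\widehat{\bm\beta}_n$ be any maximizer over $\bm\beta\in\mathbb B$ of $$\widetilde M_n(\bm\beta)=\frac2n\sum_{i=1}^n(2A_i-1)K\Big(\frac{\bm x_i^T\bm\beta}{h_n}\Big)Y_i .$$ Under (A1)–(A3) and (K1), $\widehat{\bm\beta}_n=\bm\beta_0+o_p(1)$, that is, $P(\|\widehat{\bm\beta}_n-\bm\beta_0\|\ge\varepsilon)\to0$ as $n\to\infty$ for every $\varepsilon>0$. -/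

import Mathlib

open MeasureTheory ProbabilityTheory Filter Topology

noncomputable section

namespace OptimalRegime

/-- The covariate (and parameter) space `ℝ^p` with `p = q + 1`; coordinate `0` is the distinguished
covariate `x₁`. The norm is the Euclidean one. -/
abbrev Vec (q : ℕ) : Type := EuclideanSpace ℝ (Fin (q + 1))

/-- `x ↦ x̃`: all coordinates of `x = (x₁, x̃)` but the first. -/
def tail {q : ℕ} (x : Vec q) : EuclideanSpace ℝ (Fin q) :=
  WithLp.toLp 2 (fun j => x j.succ)

/-- The linear treatment regime `d_β(x) = I(xᵀβ > 0)`. -/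
def regime {q : ℕ} (β x : Vec q) : ℝ :=
  if 0 < inner ℝ x β then 1 else 0

/-- The covariate vector `x` determined by `z = xᵀβ₀` and `x̃`
(the inverse of `x ↦ (xᵀβ₀, x̃)`, when the first coordinate of `β₀` is nonzero). -/
def ofIndex {q : ℕ} (β₀ : Vec q) (z : ℝ) (t : EuclideanSpace ℝ (Fin q)) : Vec q :=
  WithLp.toLp 2 (Fin.cons ((z - inner ℝ t (tail β₀)) / β₀ 0) (fun j => t j))

section Population

variable {Ω : Type*} [MeasurableSpace Ω]

/-- Conditional independence of `U` and `W` given `T`: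
`P(U ∈ s, W ∈ t | T) = P(U ∈ s | T) P(W ∈ t | T)` almost surely, for all measurable `s`, `t`. -/
def CondIndepGiven {α β γ : Type*} [MeasurableSpace α] [MeasurableSpace β]
    [mγ : MeasurableSpace γ] (P : Measure Ω) (U : Ω → α) (W : Ω → β) (T : Ω → γ) : Prop :=
  ∀ (s : Set α) (t : Set β), MeasurableSet s → MeasurableSet t →
    P⟦U ⁻¹' s ∩ W ⁻¹' t | mγ.comap T⟧ =ᵐ[P]
      fun ω => (P⟦U ⁻¹' s | mγ.comap T⟧) ω * (P⟦W ⁻¹' t | mγ.comap T⟧) ω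

/-- The potential-outcome model of a randomized trial: covariates `X`, binary treatment `A`,
potential outcomes `Ystar 0`, `Ystar 1` and observed outcome `Y`. -/
structure IsRandomizedTrial {q : ℕ} (P : Measure Ω) (X : Ω → Vec q) (A : Ω → ℝ)
    (Ystar : Fin 2 → Ω → ℝ) (Y : Ω → ℝ) : Prop where
  measurable_X : Measurable X
  measurable_A : Measurable A
  measurable_Ystar : ∀ a, Measurable (Ystar a)
  /-- The mean potential outcomes exist. -/
  integrable_Ystar : ∀ a, Integrable (Ystar a) P
  binary : ∀ᵐ ω ∂P, A ω = 0 ∨ A ω = 1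
  /-- Consistency: the observed outcome is the potential outcome of the treatment received. -/
  consistency : ∀ᵐ ω ∂P, Y ω = Ystar 1 ω * A ω + Ystar 0 ω * (1 - A ω)
  /-- No unmeasured confounding. -/
  unconfounded : CondIndepGiven P A (fun ω => (Ystar 0 ω, Ystar 1 ω)) X
  /-- Randomization: `P(A = 1 | x) = 1/2`. -/
  randomized : P⟦A ⁻¹' {1} | MeasurableSpace.comap X inferInstance⟧ =ᵐ[P] fun _ => (1 / 2 : ℝ)

/-- The potential outcome `Y*(d_β)` under the regime `d_β`. -/
def regimeOutcome {q : ℕ} (X : Ω → Vec q) (Ystar : Fin 2 → Ω → ℝ) (β : Vec q) (ω : Ω) : ℝ :=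
  Ystar 1 ω * regime β (X ω) + Ystar 0 ω * (1 - regime β (X ω))

/-- The value function `V(β) = E{Y*(d_β)}`. -/
def value {q : ℕ} (P : Measure Ω) (X : Ω → Vec q) (Ystar : Fin 2 → Ω → ℝ) (β : Vec q) : ℝ :=
  ∫ ω, regimeOutcome X Ystar β ω ∂P

/-- The regression function `μ(a, x) = E(Y*_a | x)`, as the mean of the conditional law of
`Y*_a` given `X = x`. -/
def regression {q : ℕ} (P : Measure Ω) [IsFiniteMeasure P] (X : Ω → Vec q)
    (Ystar : Fin 2 → Ω → ℝ) (a : Fin 2) (x : Vec q) : ℝ :=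
  ∫ y, y ∂(condDistrib (Ystar a) X P x)

/-- Outcome condition: `μ(a, x)` is bounded for almost all `x`, and for almost every `x`, given
`X = x`, the error `Y*_a - μ(a, x)` is sub-Gaussian (with a parameter that may depend on `x`). -/
structure OutcomeCondition {q : ℕ} (P : Measure Ω) [IsFiniteMeasure P] (X : Ω → Vec q)
    (Ystar : Fin 2 → Ω → ℝ) : Prop where
  bounded : ∃ C : ℝ, ∀ a, ∀ᵐ x ∂(P.map X), |regression P X Ystar a x| ≤ C
  subgaussian : ∀ a, ∀ᵐ x ∂(P.map X), ∃ c : NNReal,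
    HasSubgaussianMGF (fun y => y - regression P X Ystar a x) c (condDistrib (Ystar a) X P x)

/-- Covariate condition: the support of `x` lies in no proper linear subspace, the conditional law of
`x₁` given `x̃` has an everywhere positive density, and the components of `x̃` are bounded. -/
structure CovariateCondition {q : ℕ} (P : Measure Ω) [IsFiniteMeasure P] (X : Ω → Vec q) :
    Prop where
  support : ∀ L : Submodule ℝ (Vec q), L ≠ ⊤ → ¬ (P.map X).support ⊆ (L : Set (Vec q))
  density : ∀ᵐ t ∂(P.map (fun ω => tail (X ω))), ∃ g : ℝ → ℝ, Measurable g ∧ (∀ u, 0 < g u) ∧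
    condDistrib (fun ω => X ω 0) (fun ω => tail (X ω)) P t =
      volume.withDensity (fun u => ENNReal.ofReal (g u))
  bounded : ∃ M : ℝ, ∀ᵐ ω ∂P, ∀ j, |tail (X ω) j| ≤ M

/-- `S` is a version of the conditional treatment effect
`S(z, x̃) = E(Y*_1 - Y*_0 | z, x̃)`, where `z = xᵀβ₀`. -/
def IsConditionalEffect {q : ℕ} (P : Measure Ω) (X : Ω → Vec q) (Ystar : Fin 2 → Ω → ℝ)
    (β₀ : Vec q) (S : ℝ → EuclideanSpace ℝ (Fin q) → ℝ) : Prop :=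
  Measurable (Function.uncurry S) ∧
  (fun ω => S (inner ℝ (X ω) β₀) (tail (X ω))) =ᵐ[P]
    P[fun ω => Ystar 1 ω - Ystar 0 ω |
      MeasurableSpace.comap (fun ω => (inner ℝ (X ω) β₀, tail (X ω))) inferInstance]

/-- `f z t` is the conditional density `f(z | x̃)` of `z = xᵀβ₀` at `z` given `x̃ = t`. -/
def IsConditionalDensity {q : ℕ} (P : Measure Ω) [IsFiniteMeasure P] (X : Ω → Vec q)
    (β₀ : Vec q) (f : ℝ → EuclideanSpace ℝ (Fin q) → ℝ) : Prop :=
  Measurable (Function.uncurry f) ∧ (∀ z t, 0 ≤ f z t) ∧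
  ∀ᵐ t ∂(P.map (fun ω => tail (X ω))),
    condDistrib (fun ω => inner ℝ (X ω) β₀) (fun ω => tail (X ω)) P t =
      volume.withDensity (fun z => ENNReal.ofReal (f z t))

/-- The criterion `E_{x̃} ∫ I(xᵀβ > 0) S(z, x̃) f(z | x̃) dz`, where `x` is the covariate vector
with `xᵀβ₀ = z` and remaining coordinates `x̃`. -/
def effectCriterion {q : ℕ} (P : Measure Ω) (X : Ω → Vec q) (β₀ : Vec q)
    (S f : ℝ → EuclideanSpace ℝ (Fin q) → ℝ) (β : Vec q) : ℝ :=
  ∫ ω, (∫ z, regime β (ofIndex β₀ z (tail (X ω))) * S z (tail (X ω)) * f z (tail (X ω))) ∂P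

/-- Margin condition: `S(0, x̃) = 0` for almost every `x̃`, and `β₀` is a well-separated maximizer
over `B`: for each `ε > 0` the supremum of the criterion over `{β ∈ B : ‖β - β₀‖ > ε}` is strictly
below its value at `β₀` (a supremum over the empty set being `-∞`). -/
structure MarginCondition {q : ℕ} (P : Measure Ω) (X : Ω → Vec q) (B : Set (Vec q)) (β₀ : Vec q)
    (S f : ℝ → EuclideanSpace ℝ (Fin q) → ℝ) : Prop where
  zero : ∀ᵐ t ∂(P.map (fun ω => tail (X ω))), S 0 t = 0
  separated : ∀ ε : ℝ, 0 < ε → ∃ c : ℝ, c < effectCriterion P X β₀ S f β₀ ∧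
    ∀ β ∈ B, ε < ‖β - β₀‖ → effectCriterion P X β₀ S f β ≤ c

end Population

/-- Regularity of the smoothing function `K`. -/
structure KernelCondition (K : ℝ → ℝ) : Prop where
  differentiable : Differentiable ℝ K
  differentiable_deriv : Differentiable ℝ (deriv K)
  bv : BoundedVariationOn K Set.univ
  bv_deriv : BoundedVariationOn (deriv K) Set.univ
  bv_deriv_deriv : BoundedVariationOn (deriv (deriv K)) Set.univ
  tendsto_atBot : Tendsto K atBot (𝓝 0)
  tendsto_atTop : Tendsto K atTop (𝓝 1)
  sq_integrable_deriv : Integrable (fun v => deriv K v ^ 2)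
  sq_integrable_deriv_deriv : Integrable (fun v => deriv (deriv K) v ^ 2)

/-- The smoothed empirical value
`M̃_n(β) = (2/n) ∑_{i=1}^n (2 A_i - 1) K(x_iᵀβ / h) Y_i`, from the first `n` observations. -/
def smoothedValue {q : ℕ} (K : ℝ → ℝ) (h : ℝ) (n : ℕ) (x : ℕ → Vec q) (a y : ℕ → ℝ)
    (β : Vec q) : ℝ :=
  2 / (n : ℝ) * ∑ i ∈ Finset.range n, (2 * a i - 1) * K (inner ℝ (x i) β / h) * y i

end OptimalRegime

end

/-!
Write `W = (2A - 1) Y`. Randomization and unconfoundedness give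
`2 E{W d_β(x)} = E{(Y*_1 - Y*_0) d_β(x)}`
(`IsRandomizedTrial.two_mul_integral_weighted`), and conditioning on `(z, x̃)`, of which `x` is a
function, turns this into the criterion of the margin condition (`effectCriterion_eq_integral`). So
that condition says that `2 E{W d_β(x)}` has the well-separated maximizer `β₀`, and consistency
follows once the smoothed value is close to it uniformly over `B`, with probability tending to one.

The uniform law of large numbers (`exists_uniform_smoothedValue`) comes from compactness and needs
no entropy bound for the class of functions `x ↦ K(xᵀβ / h)`. If `‖β' - β‖ ≤ δ`, then `K(xᵀβ' / h)`
is, for small `h`, close to `I(xᵀβ > 0)` except on the band `|xᵀβ| ≤ δ (‖x‖ + 1)`, where the error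
is bounded (`abs_smooth_sub_regime_le`). The conditional density of `x₁` makes the hyperplane
`xᵀβ = 0` null (`CovariateCondition.ae_inner_ne_zero`), so `|W|` has small mass on the band when `δ`
is small (`exists_integral_band_lt`). Covering `B` by finitely many such balls leaves finitely many
averages, to which the law of large numbers applies.
-/

noncomputable section

namespace OptimalRegime

variable {q : ℕ} {Ω : Type*} [MeasurableSpace Ω]

/-! ### Linear regimes and the coordinates `(z, x̃)` -/

theorem measurable_tail : Measurable (tail : Vec q → EuclideanSpace ℝ (Fin q)) := by
  unfold tail
  fun_prop

theorem measurable_regime (β : Vec q) : Measurable (regime β) := by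
  unfold regime
  exact Measurable.ite (measurableSet_lt (by fun_prop) (by fun_prop)) (by fun_prop) (by fun_prop)

theorem abs_regime_le_one (β x : Vec q) : |regime β x| ≤ 1 := by
  unfold regime
  split_ifs <;> simp

theorem measurable_ofIndex (β₀ : Vec q) :
    Measurable (fun w : EuclideanSpace ℝ (Fin q) × ℝ => ofIndex β₀ w.2 w.1) := by
  unfold ofIndex
  refine (WithLp.measurable_toLp 2 _).comp (measurable_pi_iff.2 fun i => ?_)
  refine Fin.cases ?_ (fun j => ?_) i
  · simp only [Fin.cons_zero]
    fun_prop
  · simp only [Fin.cons_succ]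
    fun_prop

theorem inner_eq_head_add_tail (x β : Vec q) :
    inner ℝ x β = x 0 * β 0 + inner ℝ (tail x) (tail β) := by
  simp [PiLp.inner_apply, tail, Fin.sum_univ_succ, mul_comm]

theorem ofIndex_inner_tail {β₀ : Vec q} (h0 : β₀ 0 ≠ 0) (x : Vec q) :
    ofIndex β₀ (inner ℝ x β₀) (tail x) = x := by
  ext i
  refine Fin.cases ?_ (fun j => ?_) i
  · simp [ofIndex, inner_eq_head_add_tail x β₀, h0]
  · simp [ofIndex, tail]

/-- A hyperplane through the origin that is not parallel to the first axis has probability zero,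
because `x₁` has a conditional density given `x̃`. -/
theorem CovariateCondition.ae_inner_ne_zero {P : Measure Ω} [IsProbabilityMeasure P]
    {X : Ω → Vec q} (hX : Measurable X) (hA2 : CovariateCondition P X) {β : Vec q}
    (h0 : β 0 ≠ 0) : ∀ᵐ ω ∂P, inner ℝ (X ω) β ≠ 0 := by
  have hT : Measurable (fun ω => tail (X ω)) := measurable_tail.comp hX
  have hX0 : Measurable (fun ω => X ω 0) := by fun_prop
  have hm : MeasurableSet
      {w : EuclideanSpace ℝ (Fin q) × ℝ | w.2 * β 0 + inner ℝ w.1 (tail β) ≠ 0} :=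
    (measurableSet_singleton (0 : ℝ)).compl.preimage
      (f := fun w : EuclideanSpace ℝ (Fin q) × ℝ => w.2 * β 0 + inner ℝ w.1 (tail β))
      (by fun_prop)
  have key : ∀ᵐ w ∂(P.map fun ω => (tail (X ω), X ω 0)),
      w.2 * β 0 + inner ℝ w.1 (tail β) ≠ 0 := by
    rw [← compProd_map_condDistrib hX0.aemeasurable, Measure.ae_compProd_iff hm]
    filter_upwards [hA2.density] with t ht
    obtain ⟨g, -, -, hgt⟩ := ht
    rw [hgt]
    refine (withDensity_absolutelyContinuous _ _).ae_le ?_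
    have hnull : ∀ᵐ u : ℝ, u ≠ -inner ℝ t (tail β) / β 0 := by
      simp [ae_iff]
    filter_upwards [hnull] with u hu h
    apply hu
    field_simp
    linarith
  filter_upwards [ae_of_ae_map (hT.prodMk hX0).aemeasurable key] with ω hω
  rwa [inner_eq_head_add_tail]

/-! ### Identification of the criterion -/

/-- On an event determined by `x`, randomization and unconfoundedness let half of the mean of each
potential outcome be carried by the treated units. -/
theorem IsRandomizedTrial.setIntegral_treated {P : Measure Ω} [IsProbabilityMeasure P]
    {X : Ω → Vec q} {A : Ω → ℝ} {Ystar : Fin 2 → Ω → ℝ} {Y : Ω → ℝ}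
    (hT : IsRandomizedTrial P X A Ystar Y) (a : Fin 2) {s : Set (Vec q)} (hs : MeasurableSet s) :
    ∫ ω in A ⁻¹' {1} ∩ X ⁻¹' s, Ystar a ω ∂P = (1 / 2) * ∫ ω in X ⁻¹' s, Ystar a ω ∂P := by
  have hA1 : MeasurableSet (A ⁻¹' {1}) := hT.measurable_A (measurableSet_singleton 1)
  have hle : MeasurableSpace.comap X inferInstance ≤ (inferInstance : MeasurableSpace Ω) :=
    hT.measurable_X.comap_le
  have hYm : ∀ a, Measurable (Ystar a) := hT.measurable_Ystar
  have hs' : MeasurableSet (X ⁻¹' s) := hT.measurable_X hs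
  -- The law of `Y*_a` on the treated units is one half of its law on the whole event.
  have hlaw : (P.restrict (A ⁻¹' {1} ∩ X ⁻¹' s)).map (Ystar a) =
      (1 / 2 : ENNReal) • (P.restrict (X ⁻¹' s)).map (Ystar a) := by
    ext t ht
    have hpre : MeasurableSet (Ystar a ⁻¹' t) := hYm a ht
    rw [Measure.smul_apply, Measure.map_apply (hYm a) ht, Measure.map_apply (hYm a) ht,
      Measure.restrict_apply hpre, Measure.restrict_apply hpre]
    have hpair : ∃ t' : Set (ℝ × ℝ), MeasurableSet t' ∧
        (fun ω => (Ystar 0 ω, Ystar 1 ω)) ⁻¹' t' = Ystar a ⁻¹' t := by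
      fin_cases a
      · exact ⟨Prod.fst ⁻¹' t, measurable_fst ht, rfl⟩
      · exact ⟨Prod.snd ⁻¹' t, measurable_snd ht, rfl⟩
    obtain ⟨t', ht', htt'⟩ := hpair
    have hci := hT.unconfounded {1} t' (measurableSet_singleton 1) ht'
    rw [htt'] at hci
    have hreal : P.real (A ⁻¹' {1} ∩ Ystar a ⁻¹' t ∩ X ⁻¹' s) =
        (1 / 2) * P.real (Ystar a ⁻¹' t ∩ X ⁻¹' s) := by
      have h1 := setIntegral_condExp (μ := P) hle (f := (A ⁻¹' {1} ∩ Ystar a ⁻¹' t).indicator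
        fun _ => (1 : ℝ)) ((integrable_const 1).indicator (hA1.inter hpre)) ⟨s, hs, rfl⟩
      have h2 := setIntegral_condExp (μ := P) hle (f := (Ystar a ⁻¹' t).indicator
        fun _ => (1 : ℝ)) ((integrable_const 1).indicator hpre) ⟨s, hs, rfl⟩
      rw [integral_indicator_const _ (hA1.inter hpre),
        measureReal_restrict_apply (hA1.inter hpre), smul_eq_mul, mul_one] at h1
      rw [integral_indicator_const _ hpre, measureReal_restrict_apply hpre, smul_eq_mul,
        mul_one] at h2
      rw [← h1, ← h2, ← integral_const_mul]
      refine integral_congr_ae (ae_restrict_of_ae ?_)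
      filter_upwards [hci, hT.randomized] with ω h3 h4
      rw [h3, h4]
    have hset : Ystar a ⁻¹' t ∩ (A ⁻¹' {1} ∩ X ⁻¹' s) = A ⁻¹' {1} ∩ Ystar a ⁻¹' t ∩ X ⁻¹' s := by
      ext; simp; tauto
    rw [hset, ← ENNReal.ofReal_toReal (measure_ne_top P (A ⁻¹' {1} ∩ Ystar a ⁻¹' t ∩ X ⁻¹' s)),
      ← ENNReal.ofReal_toReal (measure_ne_top P (Ystar a ⁻¹' t ∩ X ⁻¹' s)),
      ← measureReal_def, ← measureReal_def, hreal, ENNReal.ofReal_mul (by norm_num), smul_eq_mul]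
    congr 1
    rw [ENNReal.ofReal_div_of_pos (by norm_num)]
    simp
  have e1 : ∀ U : Set Ω, ∫ ω in U, Ystar a ω ∂P = ∫ y, y ∂((P.restrict U).map (Ystar a)) :=
    fun U => (integral_map (hYm a).aemeasurable aestronglyMeasurable_id).symm
  rw [e1, e1, hlaw, integral_smul_measure]
  simp

/-- In a randomized trial the inverse-probability-weighted outcome `(2A - 1) Y`, averaged over the
units treated by a linear regime, recovers half of the mean treatment effect over those units. -/
theorem IsRandomizedTrial.two_mul_integral_weighted {P : Measure Ω} [IsProbabilityMeasure P]
    {X : Ω → Vec q} {A : Ω → ℝ} {Ystar : Fin 2 → Ω → ℝ} {Y : Ω → ℝ}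
    (hT : IsRandomizedTrial P X A Ystar Y) (β : Vec q) :
    2 * ∫ ω, (2 * A ω - 1) * Y ω * regime β (X ω) ∂P =
      ∫ ω, (Ystar 1 ω - Ystar 0 ω) * regime β (X ω) ∂P := by
  set s : Set (Vec q) := {x | 0 < inner ℝ x β}
  have hs : MeasurableSet s := measurableSet_lt (by fun_prop) (by fun_prop)
  have hs' : MeasurableSet (X ⁻¹' s) := hT.measurable_X hs
  have hA1 : MeasurableSet (A ⁻¹' {1}) := hT.measurable_A (measurableSet_singleton 1)
  have hreg : ∀ (g : Ω → ℝ), (fun ω => g ω * regime β (X ω)) = (X ⁻¹' s).indicator g := by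
    intro g
    ext ω
    by_cases h : 0 < inner ℝ (X ω) β <;> simp [regime, s, h]
  rw [hreg, hreg (fun ω => Ystar 1 ω - Ystar 0 ω), integral_indicator hs', integral_indicator hs']
  have hi := fun a => (hT.integrable_Ystar a).integrableOn (s := X ⁻¹' s)
  have hi' : ∀ a, Integrable ((A ⁻¹' {1}).indicator (Ystar a)) (P.restrict (X ⁻¹' s)) :=
    fun a => (hi a).indicator hA1
  have hsplit : ∀ᵐ ω ∂(P.restrict (X ⁻¹' s)), (2 * A ω - 1) * Y ω =
      (A ⁻¹' {1}).indicator (Ystar 1) ω + (A ⁻¹' {1}).indicator (Ystar 0) ω - Ystar 0 ω := by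
    refine ae_restrict_of_ae ?_
    filter_upwards [hT.binary, hT.consistency] with ω h1 h2
    rw [h2]
    rcases h1 with h | h <;> simp [Set.indicator, h]
    norm_num
  have htreated : ∀ a, ∫ ω in X ⁻¹' s, (A ⁻¹' {1}).indicator (Ystar a) ω ∂P =
      (1 / 2) * ∫ ω in X ⁻¹' s, Ystar a ω ∂P := by
    intro a
    rw [integral_indicator hA1, Measure.restrict_restrict hA1, hT.setIntegral_treated a hs]
  have hsum : Integrable (fun ω => (A ⁻¹' {1}).indicator (Ystar 1) ω +
      (A ⁻¹' {1}).indicator (Ystar 0) ω) (P.restrict (X ⁻¹' s)) := (hi' 1).add (hi' 0)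
  rw [integral_congr_ae hsplit, integral_sub hsum (hi 0), integral_add (hi' 1) (hi' 0), htreated,
    htreated, integral_sub (hi 1) (hi 0)]
  ring

theorem IsRandomizedTrial.integrable_weighted {P : Measure Ω} [IsProbabilityMeasure P]
    {X : Ω → Vec q} {A : Ω → ℝ} {Ystar : Fin 2 → Ω → ℝ} {Y : Ω → ℝ}
    (hT : IsRandomizedTrial P X A Ystar Y) : Integrable (fun ω => (2 * A ω - 1) * Y ω) P := by
  have hA1 : MeasurableSet (A ⁻¹' {1}) := hT.measurable_A (measurableSet_singleton 1)
  refine ((((hT.integrable_Ystar 1).indicator hA1).add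
    ((hT.integrable_Ystar 0).indicator hA1)).sub (hT.integrable_Ystar 0)).congr ?_
  filter_upwards [hT.binary, hT.consistency] with ω h1 h2
  rw [h2]
  rcases h1 with h | h <;> simp [Set.indicator, h]
  norm_num

/-- The criterion is `E{(Y*_1 - Y*_0) d_β(x)}`: since `x` is a function of `(z, x̃)`, the treatment
effect may be replaced by `S(z, x̃)`, and then `z` is integrated against its conditional density. -/
theorem effectCriterion_eq_integral {P : Measure Ω} [IsProbabilityMeasure P]
    {X : Ω → Vec q} (hX : Measurable X) {Ystar : Fin 2 → Ω → ℝ}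
    (hY : ∀ a, Integrable (Ystar a) P) {β₀ : Vec q} (h0 : β₀ 0 ≠ 0)
    {S f : ℝ → EuclideanSpace ℝ (Fin q) → ℝ} (hS : IsConditionalEffect P X Ystar β₀ S)
    (hf : IsConditionalDensity P X β₀ f) (β : Vec q) :
    effectCriterion P X β₀ S f β = ∫ ω, (Ystar 1 ω - Ystar 0 ω) * regime β (X ω) ∂P := by
  obtain ⟨hSm, hSe⟩ := hS
  obtain ⟨hfm, hf0, hfd⟩ := hf
  have hTm : Measurable (fun ω => tail (X ω)) := measurable_tail.comp hX
  have hZm : Measurable (fun ω => (inner ℝ (X ω) β₀ : ℝ)) := by fun_prop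
  have hZT := hZm.prodMk hTm
  have hle := hZT.comap_le
  let r : EuclideanSpace ℝ (Fin q) × ℝ → ℝ := fun w => regime β (ofIndex β₀ w.2 w.1)
  have hr : Measurable r := (measurable_regime β).comp (measurable_ofIndex β₀)
  let g : EuclideanSpace ℝ (Fin q) × ℝ → ℝ := fun w => r w * S w.2 w.1
  have hg : Measurable g := hr.mul (hSm.comp measurable_swap)
  have hSint : Integrable (fun ω => S (inner ℝ (X ω) β₀) (tail (X ω))) P :=
    integrable_condExp.congr hSe.symm
  have hrX : ∀ ω, r (tail (X ω), inner ℝ (X ω) β₀) = regime β (X ω) := fun ω => by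
    simp only [r, ofIndex_inner_tail h0]
  have hregX : Measurable (fun ω => regime β (X ω)) := (measurable_regime β).comp hX
  have hgint : Integrable (fun ω => regime β (X ω) * S (inner ℝ (X ω) β₀) (tail (X ω))) P :=
    hSint.bdd_mul hregX.aestronglyMeasurable
      (ae_of_all _ fun ω => abs_regime_le_one β (X ω))
  have hgmap : Integrable g (P.map fun ω => (tail (X ω), inner ℝ (X ω) β₀)) := by
    rw [integrable_map_measure hg.aestronglyMeasurable (hTm.prodMk hZm).aemeasurable]
    refine hgint.congr (ae_of_all _ fun ω => ?_)
    simp only [Function.comp, g, hrX]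
  have hdis : effectCriterion P X β₀ S f β =
      ∫ ω, regime β (X ω) * S (inner ℝ (X ω) β₀) (tail (X ω)) ∂P := by
    have e1 : ∫ ω, regime β (X ω) * S (inner ℝ (X ω) β₀) (tail (X ω)) ∂P =
        ∫ w, g w ∂(P.map fun ω => (tail (X ω), inner ℝ (X ω) β₀)) := by
      rw [integral_map (hTm.prodMk hZm).aemeasurable hg.aestronglyMeasurable]
      simp only [g, hrX]
    rw [e1]
    rw [← compProd_map_condDistrib hZm.aemeasurable] at hgmap ⊢
    rw [Measure.integral_compProd hgmap]
    rw [integral_map hTm.aemeasurable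
      hg.stronglyMeasurable.integral_condDistrib.aestronglyMeasurable]
    unfold effectCriterion
    refine integral_congr_ae ?_
    filter_upwards [ae_of_ae_map hTm.aemeasurable hfd] with ω hω
    rw [hω, integral_withDensity_eq_integral_toReal_smul]
    · refine integral_congr_ae (ae_of_all _ fun z => ?_)
      simp only [g, r, ENNReal.toReal_ofReal (hf0 _ _), smul_eq_mul]
      ring
    · exact (hfm.comp (measurable_id.prodMk measurable_const)).ennreal_ofReal
    · exact ae_of_all _ fun _ => ENNReal.ofReal_lt_top
  have hsm : StronglyMeasurable[MeasurableSpace.comap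
      (fun ω => (inner ℝ (X ω) β₀, tail (X ω))) inferInstance] (fun ω => regime β (X ω)) := by
    have hc : Measurable (fun w : ℝ × EuclideanSpace ℝ (Fin q) => r w.swap) :=
      hr.comp measurable_swap
    have := (hc.comp (comap_measurable (fun ω => (inner ℝ (X ω) β₀, tail (X ω)))))
    refine Measurable.stronglyMeasurable ?_
    convert this using 1
    ext ω
    exact (hrX ω).symm
  have hdiff : Integrable (fun ω => Ystar 1 ω - Ystar 0 ω) P := (hY 1).sub (hY 0)
  have hprod : Integrable (fun ω => regime β (X ω) * (Ystar 1 ω - Ystar 0 ω)) P :=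
    hdiff.bdd_mul hregX.aestronglyMeasurable
      (ae_of_all _ fun ω => abs_regime_le_one β (X ω))
  have hpull := condExp_mul_of_stronglyMeasurable_left (μ := P) hsm hprod hdiff
  have hcomm : ∫ ω, (Ystar 1 ω - Ystar 0 ω) * regime β (X ω) ∂P =
      ∫ ω, regime β (X ω) * (Ystar 1 ω - Ystar 0 ω) ∂P :=
    integral_congr_ae (ae_of_all _ fun ω => mul_comm _ _)
  have htower := integral_condExp (μ := P) hle
    (f := (fun ω => regime β (X ω)) * fun ω => Ystar 1 ω - Ystar 0 ω)
  rw [hdis, hcomm]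
  refine Eq.trans ?_ htower
  refine integral_congr_ae ?_
  filter_upwards [hSe, hpull] with ω h1 h2
  refine Eq.trans ?_ h2.symm
  rw [Pi.mul_apply, ← h1]

/-! ### Smoothed and sharp indicators -/

/-- The indicator of the band `|xᵀβ| ≤ δ (‖x‖ + 1)` about the hyperplane orthogonal to `β`. It
contains every `x` for which moving `β` by at most `δ` can bring `xᵀβ` into `[-δ, δ]` or change its
sign. -/
def band (β : Vec q) (δ : ℝ) (x : Vec q) : ℝ :=
  if |inner ℝ x β| ≤ δ * (‖x‖ + 1) then 1 else 0

theorem measurable_band (β : Vec q) (δ : ℝ) : Measurable (band β δ) := by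
  unfold band
  exact Measurable.ite (measurableSet_le (by fun_prop) (by fun_prop)) (by fun_prop) (by fun_prop)

theorem band_nonneg (β : Vec q) (δ : ℝ) (x : Vec q) : 0 ≤ band β δ x := by
  unfold band
  split_ifs <;> simp

theorem abs_band_le_one (β : Vec q) (δ : ℝ) (x : Vec q) : |band β δ x| ≤ 1 := by
  unfold band
  split_ifs <;> simp

theorem same_sign_of_not_mem_band {β β' x : Vec q} {δ : ℝ} (hβ : ‖β' - β‖ ≤ δ)
    (hx : δ * (‖x‖ + 1) < |inner ℝ x β|) :
    (0 < inner ℝ x β ∧ δ < inner ℝ x β') ∨ (inner ℝ x β < 0 ∧ inner ℝ x β' < -δ) := by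
  have hδ : 0 ≤ δ := (norm_nonneg _).trans hβ
  have h1 : |inner ℝ x β' - inner ℝ x β| ≤ ‖x‖ * δ := by
    rw [← inner_sub_right]
    exact (abs_real_inner_le_norm _ _).trans (by gcongr)
  have h2 : 0 ≤ ‖x‖ * δ := by positivity
  rw [abs_le] at h1
  rcases lt_abs.1 hx with h | h
  · left; constructor <;> nlinarith
  · right; constructor <;> nlinarith

theorem abs_regime_sub_le_band {β β' : Vec q} {δ : ℝ} (hβ : ‖β' - β‖ ≤ δ) (x : Vec q) :
    |regime β' x - regime β x| ≤ band β δ x := by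
  have hδ : 0 ≤ δ := (norm_nonneg _).trans hβ
  unfold band
  split_ifs with h
  · unfold regime
    split_ifs <;> simp
  · rcases same_sign_of_not_mem_band hβ (not_le.1 h) with ⟨h1, h2⟩ | ⟨h1, h2⟩
    · simp [regime, h1, hδ.trans_lt h2]
    · simp [regime, not_lt.2 h1.le, not_lt.2 (h2.trans_le (neg_nonpos.2 hδ)).le]

/-- Off the band, the smoothed indicator at any nearby parameter is evaluated far out in a tail of
`K`, where it agrees with the sharp indicator up to `r`. -/
theorem abs_smooth_sub_regime_le {K : ℝ → ℝ} {C r h : ℝ} (hC : ∀ v, |K v| ≤ C) (hr : 0 ≤ r)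
    (hh : 0 < h) {β β' : Vec q} {δ : ℝ} (hβ : ‖β' - β‖ ≤ δ)
    (htop : ∀ v, δ / h ≤ v → |K v - 1| ≤ r) (hbot : ∀ v, v ≤ -(δ / h) → |K v| ≤ r) (x : Vec q) :
    |K (inner ℝ x β' / h) - regime β x| ≤ r + (C + 1) * band β δ x := by
  unfold band
  split_ifs with hx
  · calc |K (inner ℝ x β' / h) - regime β x|
        ≤ |K (inner ℝ x β' / h)| + |regime β x| := abs_sub _ _
      _ ≤ C + 1 := add_le_add (hC _) (abs_regime_le_one β x)
      _ ≤ r + (C + 1) * 1 := by linarith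
  · rcases same_sign_of_not_mem_band hβ (not_le.1 hx) with ⟨h1, h2⟩ | ⟨h1, h2⟩
    · have := htop (inner ℝ x β' / h) (by gcongr)
      simpa [regime, h1] using this
    · have := hbot (inner ℝ x β' / h) (by rw [← neg_div]; gcongr)
      simpa [regime, not_lt.2 h1.le] using this

theorem KernelCondition.exists_bound {K : ℝ → ℝ} (hK : KernelCondition K) :
    ∃ C, 0 ≤ C ∧ ∀ v, |K v| ≤ C := by
  refine ⟨(eVariationOn K Set.univ).toReal + |K 0|, by positivity, fun v => ?_⟩
  have h := hK.bv.dist_le (Set.mem_univ v) (Set.mem_univ 0)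
  rw [Real.dist_eq] at h
  have := abs_sub_abs_le_abs_sub (K v) (K 0)
  linarith

theorem KernelCondition.exists_tail {K : ℝ → ℝ} (hK : KernelCondition K) {r : ℝ} (hr : 0 < r) :
    ∃ T, (∀ v, T ≤ v → |K v - 1| ≤ r) ∧ ∀ v, v ≤ -T → |K v| ≤ r := by
  obtain ⟨T₁, h₁⟩ := eventually_atTop.1 (Metric.tendsto_nhds.1 hK.tendsto_atTop r hr)
  obtain ⟨T₂, h₂⟩ := eventually_atBot.1 (Metric.tendsto_nhds.1 hK.tendsto_atBot r hr)
  refine ⟨max T₁ (-T₂), fun v hv => ?_, fun v hv => ?_⟩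
  · exact (h₁ v ((le_max_left _ _).trans hv)).le
  · simpa [Real.dist_eq] using (h₂ v (by linarith [le_max_right T₁ (-T₂)])).le

/-! ### The uniform law of large numbers -/

/-- A weight carries arbitrarily little mass on a thin enough band about a null hyperplane. -/
theorem exists_integral_band_lt {P : Measure Ω} {X : Ω → Vec q} (hX : Measurable X) {W : Ω → ℝ}
    (hW : Integrable W P) {β : Vec q} (hβ : ∀ᵐ ω ∂P, inner ℝ (X ω) β ≠ 0) {κ : ℝ} (hκ : 0 < κ) :
    ∃ δ, 0 < δ ∧ ∫ ω, |W ω| * band β δ (X ω) ∂P < κ := by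
  have hlim : Tendsto (fun k : ℕ => ∫ ω, |W ω| * band β (1 / ((k : ℝ) + 1)) (X ω) ∂P) atTop
      (𝓝 (∫ _, (0 : ℝ) ∂P)) := by
    refine tendsto_integral_of_dominated_convergence (fun ω => |W ω|) (fun k => ?_) hW.abs
      (fun k => ae_of_all _ fun ω => ?_) ?_
    · exact hW.abs.aestronglyMeasurable.mul
        ((measurable_band β _).comp hX).aestronglyMeasurable
    · rw [Real.norm_eq_abs, abs_mul, abs_abs]
      exact mul_le_of_le_one_right (abs_nonneg _) (abs_band_le_one _ _ _)
    · filter_upwards [hβ] with ω hω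
      have hsmall : Tendsto (fun k : ℕ => 1 / ((k : ℝ) + 1) * (‖X ω‖ + 1)) atTop (𝓝 0) := by
        simpa using tendsto_one_div_add_atTop_nhds_zero_nat.mul_const (‖X ω‖ + 1)
      refine tendsto_const_nhds.congr' ?_
      filter_upwards [hsmall.eventually_lt_const (abs_pos.2 hω)] with k hk
      rw [band, if_neg (not_le.2 hk), mul_zero]
  rw [integral_zero] at hlim
  obtain ⟨k, hk⟩ := (hlim.eventually_lt_const hκ).exists
  exact ⟨1 / ((k : ℝ) + 1), by positivity, hk⟩

/-- Weak law of large numbers for a function of independent copies `Zs i` of `Z`. -/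
theorem tendsto_measure_average_deviation {E Ω' : Type*} [MeasurableSpace E] [MeasurableSpace Ω']
    {P : Measure Ω} {P' : Measure Ω'} [IsProbabilityMeasure P'] {Z : Ω → E} {Zs : ℕ → Ω' → E}
    (hindep : iIndepFun Zs P') (hident : ∀ i, IdentDistrib (Zs i) Z P' P) {φ : E → ℝ}
    (hφ : Measurable φ) (hint : Integrable (fun ω => φ (Z ω)) P) {κ : ℝ} (hκ : 0 < κ) :
    Tendsto (fun n : ℕ => P' {ω | κ ≤ |(∑ i ∈ Finset.range n, φ (Zs i ω)) / n - ∫ ω, φ (Z ω) ∂P|})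
      atTop (𝓝 0) := by
  have hid : ∀ i, IdentDistrib (fun ω => φ (Zs i ω)) (fun ω => φ (Z ω)) P' P :=
    fun i => (hident i).comp hφ
  have hlaw := strong_law_ae_real (μ := P') (fun i ω => φ (Zs i ω))
    ((hid 0).integrable_iff.2 hint)
    (fun i j hij => (hindep.indepFun hij).comp hφ hφ) (fun i => (hid i).trans (hid 0).symm)
  rw [(hid 0).integral_eq] at hlaw
  have hmeas : ∀ n : ℕ, AEStronglyMeasurable
      (fun ω => (∑ i ∈ Finset.range n, φ (Zs i ω)) / (n : ℝ)) P' := fun n =>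
    ((Finset.aemeasurable_fun_sum _ fun i _ =>
      (hid i).aemeasurable_fst).div_const _).aestronglyMeasurable
  have := tendstoInMeasure_iff_norm.1
    (tendstoInMeasure_of_tendsto_ae (g := fun _ => ∫ ω, φ (Z ω) ∂P) hmeas hlaw) κ hκ
  simpa only [Real.norm_eq_abs] using this

/-- If `β'` is close to `β`, the smoothed average at `β'` is controlled by three averages that depend
only on `β`: the sharp average, the mass on the band, and the total mass. -/
theorem abs_smoothedValue_sub_le {K : ℝ → ℝ} {C r h : ℝ} (hC : ∀ v, |K v| ≤ C) (hr : 0 ≤ r)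
    (hh : 0 < h) {β β' : Vec q} {δ : ℝ} (hβ : ‖β' - β‖ ≤ δ)
    (htop : ∀ v, δ / h ≤ v → |K v - 1| ≤ r) (hbot : ∀ v, v ≤ -(δ / h) → |K v| ≤ r)
    (n : ℕ) (x : ℕ → Vec q) (a y : ℕ → ℝ) :
    |smoothedValue K h n x a y β' -
        2 * ((∑ i ∈ Finset.range n, (2 * a i - 1) * y i * regime β (x i)) / n)| ≤
      2 * (r * ((∑ i ∈ Finset.range n, |(2 * a i - 1) * y i|) / n) +
        (C + 1) * ((∑ i ∈ Finset.range n, |(2 * a i - 1) * y i| * band β δ (x i)) / n)) := by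
  have e : smoothedValue K h n x a y β' -
        2 * ((∑ i ∈ Finset.range n, (2 * a i - 1) * y i * regime β (x i)) / n) =
      2 / n * ∑ i ∈ Finset.range n,
        (2 * a i - 1) * y i * (K (inner ℝ (x i) β' / h) - regime β (x i)) := by
    have : ∀ i, (2 * a i - 1) * y i * (K (inner ℝ (x i) β' / h) - regime β (x i)) =
        (2 * a i - 1) * K (inner ℝ (x i) β' / h) * y i - (2 * a i - 1) * y i * regime β (x i) :=
      fun i => by ring
    simp only [smoothedValue, this, Finset.sum_sub_distrib]
    ring
  have e' : 2 * (r * ((∑ i ∈ Finset.range n, |(2 * a i - 1) * y i|) / n) +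
        (C + 1) * ((∑ i ∈ Finset.range n, |(2 * a i - 1) * y i| * band β δ (x i)) / n)) =
      2 / n * ∑ i ∈ Finset.range n,
        |(2 * a i - 1) * y i| * (r + (C + 1) * band β δ (x i)) := by
    have : ∀ i, |(2 * a i - 1) * y i| * (r + (C + 1) * band β δ (x i)) =
        r * |(2 * a i - 1) * y i| + (C + 1) * (|(2 * a i - 1) * y i| * band β δ (x i)) :=
      fun i => by ring
    simp only [this, Finset.sum_add_distrib, ← Finset.mul_sum]
    ring
  rw [e, e', abs_mul, abs_of_nonneg (by positivity : (0 : ℝ) ≤ 2 / n)]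
  gcongr
  refine (Finset.abs_sum_le_sum_abs _ _).trans (Finset.sum_le_sum fun i _ => ?_)
  rw [abs_mul]
  gcongr
  exact abs_smooth_sub_regime_le hC hr hh hβ htop hbot (x i)

/-- Uniform law of large numbers for the smoothed value: outside events of vanishing probability it
is uniformly close to `2 E{(2A - 1) Y d_β(x)}`. The exceptional events depend on finitely many
averages only, so that nothing is required of the measurability of suprema over `B`. -/
theorem exists_uniform_smoothedValue {Ω' : Type*} [MeasurableSpace Ω'] {P : Measure Ω}
    {P' : Measure Ω'} [IsProbabilityMeasure P']
    {X : Ω → Vec q} {A Y : Ω → ℝ} (hX : Measurable X)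
    (hW : Integrable (fun ω => (2 * A ω - 1) * Y ω) P)
    {B : Set (Vec q)} (hB : IsCompact B) (hnull : ∀ β ∈ B, ∀ᵐ ω ∂P, inner ℝ (X ω) β ≠ 0)
    {K : ℝ → ℝ} (hK : KernelCondition K) {h : ℕ → ℝ} (hpos : ∀ n, 0 < h n)
    (hlim : Tendsto h atTop (𝓝 0)) {Xs : ℕ → Ω' → Vec q} {As Ys : ℕ → Ω' → ℝ}
    (hindep : iIndepFun (fun i ω => (Xs i ω, As i ω, Ys i ω)) P')
    (hident : ∀ i, IdentDistrib (fun ω => (Xs i ω, As i ω, Ys i ω))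
      (fun ω => (X ω, A ω, Y ω)) P' P) {η : ℝ} (hη : 0 < η) :
    ∃ bad : ℕ → Set Ω', Tendsto (fun n => P' (bad n)) atTop (𝓝 0) ∧
      ∀ᶠ n in atTop, ∀ ω ∉ bad n, ∀ β ∈ B,
        |smoothedValue K (h n) n (fun i => Xs i ω) (fun i => As i ω) (fun i => Ys i ω) β -
          2 * ∫ ω, (2 * A ω - 1) * Y ω * regime β (X ω) ∂P| ≤ η := by
  classical
  obtain ⟨C, hC0, hC⟩ := hK.exists_bound
  set D := ∫ ω, |(2 * A ω - 1) * Y ω| ∂P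
  have hD0 : 0 ≤ D := integral_nonneg fun _ => abs_nonneg _
  -- The four errors below add up to at most `κ (D + 2C + 5)`.
  have hden : 0 < 2 * (D + 2 * C + 5) := by positivity
  obtain ⟨κ, hκ, hκ1, hκη⟩ : ∃ κ : ℝ, 0 < κ ∧ κ ≤ 1 ∧ κ * (2 * (D + 2 * C + 5)) ≤ η :=
    ⟨min 1 (η / (2 * (D + 2 * C + 5))), lt_min one_pos (by positivity), min_le_left _ _,
      (le_div_iff₀ hden).1 (min_le_right _ _)⟩
  have hδex : ∀ β : Vec q, ∃ δ, 0 < δ ∧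
      (β ∈ B → ∫ ω, |(2 * A ω - 1) * Y ω| * band β δ (X ω) ∂P < κ) := fun β => by
    by_cases hβ : β ∈ B
    · obtain ⟨δ, h1, h2⟩ := exists_integral_band_lt hX hW (hnull β hβ) hκ
      exact ⟨δ, h1, fun _ => h2⟩
    · exact ⟨1, one_pos, fun h => absurd h hβ⟩
  choose δ hδ0 hδ using hδex
  obtain ⟨t, htB, htcover⟩ := hB.elim_nhds_subcover (fun β => Metric.ball β (δ β))
    fun β _ => Metric.ball_mem_nhds β (hδ0 β)
  obtain ⟨T, htop, hbot⟩ := hK.exists_tail hκ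
  have hWr : ∀ β : Vec q, Integrable (fun ω => (2 * A ω - 1) * Y ω * regime β (X ω)) P :=
    fun β => hW.mul_bdd ((measurable_regime β).comp hX).aestronglyMeasurable
      (ae_of_all _ fun ω => abs_regime_le_one β (X ω))
  have hWb : ∀ β : Vec q, Integrable (fun ω => |(2 * A ω - 1) * Y ω| * band β (δ β) (X ω)) P :=
    fun β => hW.abs.mul_bdd ((measurable_band β _).comp hX).aestronglyMeasurable
      (ae_of_all _ fun ω => abs_band_le_one β _ (X ω))
  let dev : (Vec q × ℝ × ℝ → ℝ) → ℕ → Set Ω' := fun φ n =>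
    {ω | κ ≤ |(∑ i ∈ Finset.range n, φ (Xs i ω, As i ω, Ys i ω)) / n -
      ∫ ω, φ (X ω, A ω, Y ω) ∂P|}
  let φr : Vec q → Vec q × ℝ × ℝ → ℝ := fun β z => (2 * z.2.1 - 1) * z.2.2 * regime β z.1
  let φb : Vec q → Vec q × ℝ × ℝ → ℝ := fun β z => |(2 * z.2.1 - 1) * z.2.2| * band β (δ β) z.1
  let φa : Vec q × ℝ × ℝ → ℝ := fun z => |(2 * z.2.1 - 1) * z.2.2|
  have hφr : ∀ β, Measurable (φr β) := fun β =>
    Measurable.mul (by fun_prop) ((measurable_regime β).comp measurable_fst)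
  have hφb : ∀ β, Measurable (φb β) := fun β =>
    Measurable.mul (by fun_prop) ((measurable_band β _).comp measurable_fst)
  have hφa : Measurable φa := by fun_prop
  have hdr : ∀ β, Tendsto (fun n => P' (dev (φr β) n)) atTop (𝓝 0) := fun β =>
    tendsto_measure_average_deviation hindep hident (hφr β) (hWr β) hκ
  have hdb : ∀ β, Tendsto (fun n => P' (dev (φb β) n)) atTop (𝓝 0) := fun β =>
    tendsto_measure_average_deviation hindep hident (hφb β) (hWb β) hκ
  have hda : Tendsto (fun n => P' (dev φa n)) atTop (𝓝 0) :=
    tendsto_measure_average_deviation hindep hident hφa hW.abs hκ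
  refine ⟨fun n => (⋃ β ∈ t, (dev (φr β) n ∪ dev (φb β) n)) ∪ dev φa n, ?_, ?_⟩
  · have hsum : Tendsto (fun n => ∑ β ∈ t, (P' (dev (φr β) n) + P' (dev (φb β) n)) +
        P' (dev φa n)) atTop (𝓝 0) := by
      have := (tendsto_finsetSum t fun β _ => (hdr β).add (hdb β)).add hda
      simpa using this
    refine tendsto_of_tendsto_of_tendsto_of_le_of_le tendsto_const_nhds hsum
      (fun _ => zero_le) fun n => ?_
    refine (measure_union_le _ _).trans (add_le_add_left ?_ _)
    exact (measure_biUnion_finset_le _ _).trans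
      (Finset.sum_le_sum fun β _ => measure_union_le _ _)
  have hsmall : ∀ᶠ n in atTop, ∀ β ∈ t, h n * T < δ β :=
    (Filter.eventually_all_finset t).2 fun β _ =>
      (by simpa using hlim.mul_const T : Tendsto (fun n => h n * T) atTop (𝓝 0)).eventually_lt_const
        (hδ0 β)
  filter_upwards [hsmall] with n hn ω hω β' hβ'
  obtain ⟨β, hβt, hball⟩ : ∃ β ∈ t, β' ∈ Metric.ball β (δ β) := by simpa using htcover hβ'
  have hclose : ‖β' - β‖ ≤ δ β := by
    rw [← dist_eq_norm]
    exact (Metric.mem_ball.1 hball).le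
  have hT : T ≤ δ β / h n := by
    rw [le_div_iff₀ (hpos n), mul_comm]
    exact (hn β hβt).le
  simp only [Set.mem_union, Set.mem_iUnion, not_or, not_exists] at hω
  obtain ⟨hω1, hωa⟩ := hω
  obtain ⟨hωr, hωb⟩ := hω1 β hβt
  have hωr : |(∑ i ∈ Finset.range n, (2 * As i ω - 1) * Ys i ω * regime β (Xs i ω)) / (n : ℝ) -
      ∫ ω, (2 * A ω - 1) * Y ω * regime β (X ω) ∂P| < κ := not_le.1 hωr
  have hωb : |(∑ i ∈ Finset.range n, |(2 * As i ω - 1) * Ys i ω| * band β (δ β) (Xs i ω)) /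
      (n : ℝ) -
      ∫ ω, |(2 * A ω - 1) * Y ω| * band β (δ β) (X ω) ∂P| < κ := not_le.1 hωb
  have hωa : |(∑ i ∈ Finset.range n, |(2 * As i ω - 1) * Ys i ω|) / (n : ℝ) - D| < κ :=
    not_le.1 hωa
  have hsm := abs_smoothedValue_sub_le hC hκ.le (hpos n) hclose
    (fun v hv => htop v (hT.trans hv)) (fun v hv => hbot v (hv.trans (neg_le_neg hT)))
    n (fun i => Xs i ω) (fun i => As i ω) (fun i => Ys i ω)
  have hpop : |∫ ω, (2 * A ω - 1) * Y ω * regime β' (X ω) ∂P -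
      ∫ ω, (2 * A ω - 1) * Y ω * regime β (X ω) ∂P| ≤
      ∫ ω, |(2 * A ω - 1) * Y ω| * band β (δ β) (X ω) ∂P := by
    rw [← integral_sub (hWr β') (hWr β)]
    refine (abs_integral_le_integral_abs).trans
      (integral_mono_of_nonneg (ae_of_all _ fun _ => abs_nonneg _) (hWb β)
        (ae_of_all _ fun ω => ?_))
    simp only
    rw [← mul_sub, abs_mul]
    exact mul_le_mul_of_nonneg_left (abs_regime_sub_le_band hclose (X ω)) (abs_nonneg _)
  have hδβ := hδ β (htB β hβt)
  beta_reduce at hsm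
  generalize smoothedValue K (h n) n (fun i => Xs i ω) (fun i => As i ω) (fun i => Ys i ω) β' = M
    at hsm ⊢
  generalize (∑ i ∈ Finset.range n, (2 * As i ω - 1) * Ys i ω * regime β (Xs i ω)) / (n : ℝ) = R
    at hsm hωr
  generalize (∑ i ∈ Finset.range n, |(2 * As i ω - 1) * Ys i ω| * band β (δ β) (Xs i ω)) / (n : ℝ)
    = N at hsm hωb
  generalize (∑ i ∈ Finset.range n, |(2 * As i ω - 1) * Ys i ω|) / (n : ℝ) = W at hsm hωa
  have hWle : κ * W ≤ κ * (D + 1) := by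
    gcongr
    linarith [(abs_lt.1 hωa).2]
  have hNle : (C + 1) * N ≤ (C + 1) * (2 * κ) := by
    gcongr
    linarith [(abs_lt.1 hωb).2]
  rw [abs_le] at hsm hpop ⊢
  rw [abs_lt] at hωr
  constructor <;> nlinarith

end OptimalRegime

end

/-! ### Consistency -/

theorem theorem1 {q : ℕ}
    -- population
    {Ω : Type*} [MeasurableSpace Ω] (P : Measure Ω) [IsProbabilityMeasure P]
    (X : Ω → OptimalRegime.Vec q) (A : Ω → ℝ) (Ystar : Fin 2 → Ω → ℝ) (Y : Ω → ℝ)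
    (hTrial : OptimalRegime.IsRandomizedTrial P X A Ystar Y)
    -- parameter set, normalized by `|β₁| = 1`, and optimal parameter
    (B : Set (OptimalRegime.Vec q)) (hB : IsCompact B) (hBnorm : ∀ β ∈ B, |β 0| = 1)
    (β₀ : OptimalRegime.Vec q) (hβ₀ : β₀ ∈ B)
    (hβ₀max : IsMaxOn (OptimalRegime.value P X Ystar) B β₀)
    -- conditional treatment effect and conditional density
    (S f : ℝ → EuclideanSpace ℝ (Fin q) → ℝ)
    (hS : OptimalRegime.IsConditionalEffect P X Ystar β₀ S)
    (hf : OptimalRegime.IsConditionalDensity P X β₀ f)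
    -- regularity conditions
    (hA1 : OptimalRegime.OutcomeCondition P X Ystar)
    (hA2 : OptimalRegime.CovariateCondition P X)
    (hA3 : OptimalRegime.MarginCondition P X B β₀ S f)
    -- smoothing function and bandwidths
    (K : ℝ → ℝ) (hK : OptimalRegime.KernelCondition K)
    (h : ℕ → ℝ) (hpos : ∀ n, 0 < h n) (hlim : Tendsto h atTop (𝓝 0))
    -- independent copies of `(x, A, Y)`
    {Ω' : Type*} [MeasurableSpace Ω'] (P' : Measure Ω') [IsProbabilityMeasure P']
    (Xs : ℕ → Ω' → OptimalRegime.Vec q) (As Ys : ℕ → Ω' → ℝ)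
    (hindep : iIndepFun (fun i ω => (Xs i ω, As i ω, Ys i ω)) P')
    (hident : ∀ i, IdentDistrib (fun ω => (Xs i ω, As i ω, Ys i ω))
      (fun ω => (X ω, A ω, Y ω)) P' P)
    -- the smoothed robust estimator
    (βhat : ℕ → Ω' → OptimalRegime.Vec q)
    (hβhat : ∀ n, 0 < n → ∀ᵐ ω ∂P', βhat n ω ∈ B ∧
      IsMaxOn (OptimalRegime.smoothedValue K (h n) n
        (fun i => Xs i ω) (fun i => As i ω) (fun i => Ys i ω)) B (βhat n ω)) :
    TendstoInMeasure P' βhat atTop (fun _ => β₀) := by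
  have h0 : ∀ β ∈ B, β 0 ≠ 0 := fun β hβ h => by simpa [h] using hBnorm β hβ
  have hcrit : ∀ β, OptimalRegime.effectCriterion P X β₀ S f β =
      2 * ∫ ω, (2 * A ω - 1) * Y ω * OptimalRegime.regime β (X ω) ∂P := fun β => by
    rw [hTrial.two_mul_integral_weighted, OptimalRegime.effectCriterion_eq_integral
      hTrial.measurable_X hTrial.integrable_Ystar (h0 β₀ hβ₀) hS hf]
  rw [tendstoInMeasure_iff_norm]
  intro ε hε
  -- The separation in the margin condition is beyond a strict inequality, whence the halved radius.
  obtain ⟨c, hc, hsep⟩ := hA3.separated (ε / 2) (half_pos hε)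
  set gap := OptimalRegime.effectCriterion P X β₀ S f β₀ - c with hgap
  have hgap0 : 0 < gap := sub_pos.2 hc
  obtain ⟨bad, hbad, hunif⟩ := OptimalRegime.exists_uniform_smoothedValue (A := A) (Y := Y)
    hTrial.measurable_X hTrial.integrable_weighted hB
    (fun β hβ => hA2.ae_inner_ne_zero hTrial.measurable_X (h0 β hβ)) hK hpos hlim hindep hident
    (η := gap / 3) (by positivity)
  refine tendsto_of_tendsto_of_tendsto_of_le_of_le' tendsto_const_nhds hbad
    (Eventually.of_forall fun _ => zero_le) ?_
  filter_upwards [hunif, eventually_gt_atTop 0] with n hn hn0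
  refine measure_mono_ae ?_
  filter_upwards [hβhat n hn0] with ω hω hfar
  by_contra hgood
  obtain ⟨hmem, hmax⟩ := hω
  have h1 := abs_le.1 (hn ω hgood _ hmem)
  have h2 := abs_le.1 (hn ω hgood _ hβ₀)
  have h3 := hsep _ hmem ((half_lt_self hε).trans_le hfar)
  have h4 := hmax hβ₀
  rw [← hcrit] at h1 h2
  simp only [Set.mem_ofPred_eq] at h4
  linarith [h1.1, h1.2, h2.1, h2.2]
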